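/- Let $d,n\ge 0$ be integers, let $\mathbb{R}^d[t]$ denote the real vector space of univariate real polynomials of degree at most $d$, and let $\|\cdot\|$ be any norm on $\mathbb{R}^d[t]$. Call a polynomial in $\mathbb{R}^d[t]$ real-rooted if all of its complex roots are real, with the convention that the zero polynomial is real-rooted. For a family $\boldsymbol f=(f_1,\ldots,f_n)\subset\mathbb{R}^d[t]$, call $\boldsymbol f$ compatible if every non-negative linear combination $\sum_i a_i f_i$ ($a_i\ge 0$) is real-rooted, and let $\Delta(\boldsymbol f)$ denote the simplex generated by $\boldsymbol f$, that is, the set of all convex combinations of $f_1,\ldots,f_n$. Theorem. Let $\boldsymbol f=(f_1,\ldots,f_n)\subset\mathbb{R}^d[t]$ be compatible and such that $0\notin\Delta(\boldsymbol f)$. Then for all $\epsilon>0$ small enough there exists a family $\tilde{\boldsymbol f}=(\tilde f_1,\ldots,\tilde f_n)\subset\mathbb{R}^d[t]$ such that $\|f_i-\tilde f_i\|<\epsilon$ for all $i$ and $\Delta(\tilde{\boldsymbol f})$ is contained in the interior (with respect to the topology of $\|\cdot\|$ on $\mathbb{R}^d[t]$) of the set of real-rooted polynomials in $\mathbb{R}^d[t]$.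 -/

import Mathlib

open Polynomial

noncomputable section

/-- The real vector space `ℝ^d[t]` of real univariate polynomials of degree at most `d`. -/
abbrev PolyLE (d : ℕ) : Type := Polynomial.degreeLE ℝ (d : WithBot ℕ)

/-- A real polynomial is real-rooted if all its complex roots are real; by convention the zero
polynomial is real-rooted (and a nonzero constant, having no roots, is real-rooted as well). -/
def RealRooted (p : ℝ[X]) : Prop :=
  p = 0 ∨ ∀ z : ℂ, aeval z p = 0 → z.im = 0

/-- The set of real-rooted polynomials in `ℝ^d[t]`. -/
def realRootedSet (d : ℕ) : Set (PolyLE d) := {p | RealRooted (p : ℝ[X])}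

/-- The simplex `Δ(f)`: the set of all convex combinations of `f_1, …, f_n`. -/
def polySimplex {d n : ℕ} (f : Fin n → PolyLE d) : Set (PolyLE d) :=
  convexHull ℝ (Set.range f)

/-- A family is compatible if all its non-negative linear combinations are real-rooted. -/
def Compatible {d n : ℕ} (f : Fin n → PolyLE d) : Prop :=
  ∀ a : Fin n → ℝ, (∀ i, 0 ≤ a i) → ∑ i, a i • f i ∈ realRootedSet d

/-- The topology of a norm `N` on `ℝ^d[t]`, i.e. the topology of the metric
`(p, q) ↦ N (p - q)`. -/
abbrev normTopology {d : ℕ} (N : Seminorm ℝ (PolyLE d)) : TopologicalSpace (PolyLE d) :=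
  N.toAddGroupSeminorm.toSeminormedAddCommGroup.toPseudoMetricSpace.toUniformSpace.toTopologicalSpace

end

open Polynomial ComplexConjugate

noncomputable section

/-! ### Real-rootedness and splitting -/

/-! A single linear operator, `separate d s`, perturbs the whole family. It tends to the identity as
`s → 0` and preserves real-rootedness. For `s ≠ 0` it sends every nonzero real-rooted polynomial of
degree at most `d` to one with simple roots and degree at least `d - 1`, i.e. at most a simple root
at infinity. By linearity it maps simplex to simplex, and `0 ∉ Δ(f)` makes every point of the
simplex a nonzero polynomial (`separate_spec`). Such an image is interior: its simple roots are sign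
changes, which persist nearby. A nearby `q` of degree at most `d` thus keeps at least `d - 1` real
roots, and the remaining factor is linear or constant (`mem_interior_realRootedSet`). The operator
is `(1 + sD)^d ∘ M ∘ (1 + sD)^d`. The factor `1 + sD` lowers multiplicities and creates only simple
new roots, but keeps the degree and so does not affect the root at infinity. The Möbius substitution
`M` exchanges infinity with a finite point: the first power makes the new root at infinity at most
simple, and the second separates the roots that came from the old one. -/

theorem Polynomial.Splits.im_eq_zero {p : ℝ[X]} (hp : p.Splits) (h0 : p ≠ 0) {z : ℂ}
    (hz : aeval z p = 0) : z.im = 0 := by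
  obtain ⟨x, rfl⟩ := hp.mem_range_of_isRoot (i := algebraMap ℝ ℂ) h0
    (by rwa [IsRoot, eval_map_algebraMap])
  simp

theorem realRooted_iff_splits {p : ℝ[X]} : RealRooted p ↔ p.Splits := by
  constructor
  · rintro (rfl | h)
    · exact Splits.zero
    · refine Splits.of_splits_map (algebraMap ℝ ℂ) (IsAlgClosed.splits _) fun z hz => ?_
      have := h z (by
        have := isRoot_of_mem_roots hz
        rwa [IsRoot, eval_map_algebraMap] at this)
      exact ⟨z.re, Complex.ext (by simp) (by simp [this])⟩
  · intro h
    by_cases h0 : p = 0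
    · exact Or.inl h0
    · exact Or.inr fun z hz => h.im_eq_zero h0 hz

theorem splits_of_natDegree_le_card_roots_add_one {q : ℝ[X]}
    (h : q.natDegree ≤ q.roots.card + 1) : q.Splits := by
  obtain ⟨r, hr, hd, -⟩ := exists_prod_multiset_X_sub_C_mul q
  rw [← hr]
  refine Splits.mul (Splits.multisetProd fun f hf => ?_) (Splits.of_natDegree_le_one (by omega))
  obtain ⟨a, -, rfl⟩ := Multiset.mem_map.1 hf
  exact Splits.X_sub_C a

/-! ### Two inequalities for polynomials that split over the reals -/

/-- Laguerre's inequality, with the equality case at points that are not roots. -/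
theorem Polynomial.Splits.laguerre {p : ℝ[X]} (hp : p.Splits) (t : ℝ) :
    0 ≤ p.derivative.eval t ^ 2 - p.eval t * p.derivative.derivative.eval t ∧
      (p.eval t ≠ 0 →
        p.derivative.eval t ^ 2 - p.eval t * p.derivative.derivative.eval t = 0 →
          p.derivative = 0) := by
  induction hp using Submonoid.closure_induction with
  | mem x hx =>
    rcases hx with ⟨a, rfl⟩ | ⟨a, rfl⟩ <;> simp
  | one => simp
  | mul x y _ _ hx hy =>
    -- Off the roots, the expression is `-p² (log p)''`, and `log` turns products into sums.
    have key : (x * y).derivative.eval t ^ 2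
        - (x * y).eval t * (x * y).derivative.derivative.eval t =
        x.eval t ^ 2 * (y.derivative.eval t ^ 2 - y.eval t * y.derivative.derivative.eval t) +
        y.eval t ^ 2 *
          (x.derivative.eval t ^ 2 - x.eval t * x.derivative.derivative.eval t) := by
      simp only [derivative_mul, derivative_add, eval_add, eval_mul]; ring
    rw [key]
    have h1 := mul_nonneg (sq_nonneg (x.eval t)) hy.1
    have h2 := mul_nonneg (sq_nonneg (y.eval t)) hx.1
    refine ⟨add_nonneg h1 h2, fun h0 h => ?_⟩
    rw [eval_mul] at h0
    have hx0 := left_ne_zero_of_mul h0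
    have hy0 := right_ne_zero_of_mul h0
    have e1 := (mul_eq_zero.1 (le_antisymm (by linarith) h1)).resolve_left (pow_ne_zero 2 hx0)
    have e2 := (mul_eq_zero.1 (le_antisymm (by linarith) h2)).resolve_left (pow_ne_zero 2 hy0)
    rw [derivative_mul, hx.2 hx0 e2, hy.2 hy0 e1]
    simp

/-- The logarithmic derivative of a polynomial that splits over the reals has non-zero imaginary
part away from the real axis, unless the polynomial is constant. -/
theorem Polynomial.Splits.im_derivative_mul_conj {p : ℝ[X]} (hp : p.Splits) {z : ℂ}
    (hz : z.im ≠ 0) :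
    z.im * (aeval z p.derivative * conj (aeval z p)).im ≤ 0 ∧
      (aeval z p ≠ 0 → z.im * (aeval z p.derivative * conj (aeval z p)).im = 0 →
        p.derivative = 0) := by
  induction hp using Submonoid.closure_induction with
  | mem x hx =>
    rcases hx with ⟨a, rfl⟩ | ⟨a, rfl⟩
    · simp
    · simp [hz, mul_self_nonneg]
  | one => simp
  | mul x y _ _ hx hy =>
    -- Off the roots, `p' * conj p = |p|² (p'/p)`, and logarithmic derivatives add.
    have key : z.im * (aeval z (x * y).derivative * conj (aeval z (x * y))).im =
        Complex.normSq (aeval z x) * (z.im * (aeval z y.derivative * conj (aeval z y)).im) +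
        Complex.normSq (aeval z y) * (z.im * (aeval z x.derivative * conj (aeval z x)).im) := by
      simp only [derivative_mul, map_add, map_mul, Complex.normSq_apply, Complex.add_im,
        Complex.mul_im, Complex.mul_re, Complex.conj_re, Complex.conj_im, Complex.add_re]
      ring
    rw [key]
    have h1 := mul_nonpos_of_nonneg_of_nonpos (Complex.normSq_nonneg (aeval z x)) hy.1
    have h2 := mul_nonpos_of_nonneg_of_nonpos (Complex.normSq_nonneg (aeval z y)) hx.1
    refine ⟨add_nonpos h1 h2, fun h0 h => ?_⟩
    rw [map_mul] at h0
    have hx0 := left_ne_zero_of_mul h0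
    have hy0 := right_ne_zero_of_mul h0
    have e1 := (mul_eq_zero.1 (le_antisymm h1 (by linarith))).resolve_left
      (by rwa [Complex.normSq_eq_zero])
    have e2 := (mul_eq_zero.1 (le_antisymm h2 (by linarith))).resolve_left
      (by rwa [Complex.normSq_eq_zero])
    rw [derivative_mul, hx.2 hx0 e2, hy.2 hy0 e1]
    simp

/-! ### The operator `p ↦ p + s p'` -/

/-- The operator `p ↦ p + s p'`. -/
def addDeriv (s : ℝ) : ℝ[X] →ₗ[ℝ] ℝ[X] := LinearMap.id + s • derivative

theorem addDeriv_apply (s : ℝ) (p : ℝ[X]) : addDeriv s p = p + C s * p.derivative := by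
  simp [addDeriv, smul_eq_C_mul]

theorem natDegree_addDeriv_le (s : ℝ) (p : ℝ[X]) : (addDeriv s p).natDegree ≤ p.natDegree := by
  rw [addDeriv_apply]
  exact natDegree_add_le_of_degree_le le_rfl
    ((natDegree_C_mul_le _ _).trans ((natDegree_derivative_le p).trans (Nat.sub_le _ _)))

theorem coeff_natDegree_addDeriv (s : ℝ) (p : ℝ[X]) :
    (addDeriv s p).coeff p.natDegree = p.leadingCoeff := by
  simp [addDeriv_apply, coeff_derivative]

theorem addDeriv_ne_zero (s : ℝ) {p : ℝ[X]} (hp : p ≠ 0) : addDeriv s p ≠ 0 := fun h => by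
  have := coeff_natDegree_addDeriv s p
  rw [h, coeff_zero, eq_comm, leadingCoeff_eq_zero] at this
  exact hp this

theorem natDegree_addDeriv (s : ℝ) (p : ℝ[X]) : (addDeriv s p).natDegree = p.natDegree := by
  refine le_antisymm (natDegree_addDeriv_le s p) ?_
  by_cases hp : p = 0
  · simp [hp]
  · exact le_natDegree_of_ne_zero (by rwa [coeff_natDegree_addDeriv, leadingCoeff_ne_zero])

/-- At a nonreal root, `p = -s p'` would make `p' * conj p` real, which is the equality case of
`im_derivative_mul_conj`. -/
theorem Polynomial.Splits.addDeriv (s : ℝ) {p : ℝ[X]} (hp : p.Splits) :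
    (addDeriv s p).Splits := by
  by_cases h0 : p = 0
  · simp [h0]
  refine realRooted_iff_splits.1 (Or.inr fun z hz => ?_)
  by_contra him
  have hpz : aeval z p ≠ 0 := fun h => him (hp.im_eq_zero h0 h)
  have hz' : aeval z p = -(s * aeval z p.derivative) := by
    rw [addDeriv_apply] at hz
    simp only [map_add, map_mul, aeval_C, Complex.coe_algebraMap] at hz
    linear_combination hz
  have hd := (hp.im_derivative_mul_conj him).2 hpz (by
    rw [hz']
    simp only [map_neg, map_mul, Complex.conj_ofReal, Complex.mul_im, Complex.neg_re,
      Complex.neg_im, Complex.mul_re, Complex.ofReal_re, Complex.ofReal_im, Complex.conj_re,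
      Complex.conj_im]
    ring)
  rw [hd] at hz'
  exact hpz (by simpa using hz')

/-- At a root of `p` of multiplicity `m`, the derivative has multiplicity exactly `m - 1`. At a
non-root of `p`, a double root of `p + s p'` would force equality in Laguerre's inequality. -/
theorem rootMultiplicity_addDeriv_le {s : ℝ} (hs : s ≠ 0) {p : ℝ[X]} (hp : p.Splits)
    (h0 : p ≠ 0) (t : ℝ) :
    (addDeriv s p).rootMultiplicity t ≤ max 1 (p.rootMultiplicity t - 1) := by
  have hT := addDeriv_ne_zero s h0
  by_cases ht : p.IsRoot t
  · refine le_max_of_le_right ?_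
    by_contra! hlt
    have hm := (rootMultiplicity_pos h0).2 ht
    have hp' : p.derivative ≠ 0 := fun h => by
      obtain ⟨a, rfl⟩ := natDegree_eq_zero.1 (derivative_eq_zero.1 h)
      simp_all
    have h1 : (X - C t) ^ p.rootMultiplicity t ∣ addDeriv s p :=
      (le_rootMultiplicity_iff hT).1 (by omega)
    rw [addDeriv_apply] at h1
    have h2 := (dvd_add_right (pow_rootMultiplicity_dvd p t)).1 h1
    rw [(isUnit_C.2 hs.isUnit).dvd_mul_left] at h2
    have h3 := (le_rootMultiplicity_iff hp').2 h2
    rw [derivative_rootMultiplicity_of_root ht] at h3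
    omega
  · refine le_max_of_le_left ?_
    by_contra! hlt
    have hroot := (one_lt_rootMultiplicity_iff_isRoot hT).1 hlt
    simp only [addDeriv_apply, IsRoot, derivative_add, derivative_C_mul, eval_add, eval_mul,
      eval_C] at hroot
    obtain ⟨h1, h2⟩ := hroot
    have hd := (hp.laguerre t).2 ht (by
      linear_combination p.derivative.eval t * h2 - p.derivative.derivative.eval t * h1)
    rw [hd] at h1
    exact ht (by simpa using h1)

theorem addDeriv_pow_spec {s : ℝ} (hs : s ≠ 0) {p : ℝ[X]} (hp : p.Splits) (h0 : p ≠ 0) (k : ℕ) :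
    ((addDeriv s ^ k) p).Splits ∧ (addDeriv s ^ k) p ≠ 0 ∧
      ((addDeriv s ^ k) p).natDegree = p.natDegree ∧
      ∀ t, ((addDeriv s ^ k) p).rootMultiplicity t ≤ max 1 (p.rootMultiplicity t - k) := by
  induction k with
  | zero => simp [hp, h0]
  | succ k ih =>
    obtain ⟨h1, h2, h3, h4⟩ := ih
    rw [pow_succ', Module.End.mul_apply]
    refine ⟨h1.addDeriv s, addDeriv_ne_zero s h2, (natDegree_addDeriv s _).trans h3,
      fun t => ?_⟩
    have := rootMultiplicity_addDeriv_le hs h1 h2 t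
    have := h4 t
    omega

theorem rootMultiplicity_addDeriv_pow_le_one {s : ℝ} (hs : s ≠ 0) {p : ℝ[X]} (hp : p.Splits)
    (h0 : p ≠ 0) {d : ℕ} (hd : p.natDegree ≤ d) (t : ℝ) :
    ((addDeriv s ^ d) p).rootMultiplicity t ≤ 1 := by
  have h1 := (addDeriv_pow_spec hs hp h0 d).2.2.2 t
  have h2 : p.rootMultiplicity t ≤ p.natDegree := by
    rw [← count_roots]
    exact (Multiset.count_le_card _ _).trans (card_roots' p)
  omega

/-! ### The Möbius operator -/

/-- The substitution `p ↦ (1 + s t) ^ d * p (t / (1 + s t))` on polynomials of degree at most `d`. -/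
def mobius (d : ℕ) (s : ℝ) : ℝ[X] →ₗ[ℝ] ℝ[X] :=
  ∑ i ∈ Finset.range (d + 1), (lcoeff ℝ i).smulRight (X ^ i * (1 + C s * X) ^ (d - i))

theorem mobius_apply (d : ℕ) (s : ℝ) (p : ℝ[X]) :
    mobius d s p =
      ∑ i ∈ Finset.range (d + 1), C (p.coeff i) * (X ^ i * (1 + C s * X) ^ (d - i)) := by
  simp [mobius, LinearMap.sum_apply, smul_eq_C_mul]

theorem natDegree_mobius_le (d : ℕ) (s : ℝ) (p : ℝ[X]) : (mobius d s p).natDegree ≤ d := by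
  rw [mobius_apply]
  refine natDegree_sum_le_of_forall_le _ _ fun i hi => ?_
  have hi := Finset.mem_range.1 hi
  have h1 : (1 + C s * X : ℝ[X]).natDegree ≤ 1 := by compute_degree
  have h2 : ((1 + C s * X : ℝ[X]) ^ (d - i)).natDegree ≤ (d - i) * 1 :=
    natDegree_pow_le_of_le _ h1
  have h3 : (X ^ i * (1 + C s * X : ℝ[X]) ^ (d - i)).natDegree ≤ i + (d - i) * 1 :=
    natDegree_mul_le_of_le (natDegree_X_pow_le i) h2
  exact (natDegree_C_mul_le _ _).trans (h3.trans (by omega))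

theorem aeval_mobius {A : Type*} [Field A] [Algebra ℝ A] {d : ℕ} (s : ℝ) {p : ℝ[X]}
    (hp : p.natDegree ≤ d) {z : A} (hz : 1 + algebraMap ℝ A s * z ≠ 0) :
    aeval z (mobius d s p) =
      (1 + algebraMap ℝ A s * z) ^ d * aeval (z / (1 + algebraMap ℝ A s * z)) p := by
  rw [mobius_apply, aeval_eq_sum_range' (Nat.lt_succ_of_le hp), map_sum, Finset.mul_sum]
  refine Finset.sum_congr rfl fun i hi => ?_
  have hi : i ≤ d := Nat.lt_succ_iff.1 (Finset.mem_range.1 hi)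
  simp only [map_mul, map_pow, map_add, map_one, aeval_C, aeval_X, Algebra.smul_def, div_pow]
  rw [← Nat.sub_add_cancel hi, pow_add _ (d - i) i, Nat.add_sub_cancel]
  field_simp

theorem mobius_neg_mobius {d : ℕ} (s : ℝ) {p : ℝ[X]} (hp : p.natDegree ≤ d) :
    mobius d (-s) (mobius d s p) = p := by
  -- The extra factor vanishes at the pole `1/s`, the one point where the substitution formula is
  -- unavailable.
  have h : (1 - C s * X) * (mobius d (-s) (mobius d s p) - p) = 0 := by
    refine Polynomial.funext fun x => ?_
    by_cases hx : 1 - s * x = 0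
    · simp [hx]
    · have h1 := aeval_mobius (A := ℝ) (-s) (natDegree_mobius_le d s p) (z := x)
        (by simpa [← sub_eq_add_neg] using hx)
      have e : 1 + s * (x / (1 - s * x)) = (1 - s * x)⁻¹ := by field_simp; ring
      have h2 := aeval_mobius (A := ℝ) s hp (z := x / (1 - s * x))
        (by simpa [e] using hx)
      simp only [Algebra.algebraMap_self, RingHom.id_apply, coe_aeval_eq_eval, neg_mul,
        ← sub_eq_add_neg] at h1 h2
      rw [h2, e] at h1
      have e2 : x / (1 - s * x) / (1 - s * x)⁻¹ = x := by
        rw [div_inv_eq_mul, div_mul_cancel₀ _ hx]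
      rw [e2, ← mul_assoc, ← mul_pow, mul_inv_cancel₀ hx] at h1
      simp [h1]
  have hne : (1 - C s * X : ℝ[X]) ≠ 0 := fun h => by simpa using congrArg (eval 0) h
  exact sub_eq_zero.1 ((mul_eq_zero.1 h).resolve_left hne)

theorem mobius_ne_zero {d : ℕ} (s : ℝ) {p : ℝ[X]} (hp : p.natDegree ≤ d) (h0 : p ≠ 0) :
    mobius d s p ≠ 0 := fun h => h0 (by rw [← mobius_neg_mobius s hp, h, map_zero])

theorem Polynomial.Splits.mobius {d : ℕ} (s : ℝ) {p : ℝ[X]} (hp : p.Splits)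
    (hd : p.natDegree ≤ d) : (mobius d s p).Splits := by
  by_cases h0 : p = 0
  · simp [h0]
  refine realRooted_iff_splits.1 (Or.inr fun z hz => ?_)
  by_contra him
  have hne : 1 + algebraMap ℝ ℂ s * z ≠ 0 := fun h => by
    have h1 := congrArg Complex.im h
    have h2 := congrArg Complex.re h
    simp only [Complex.coe_algebraMap, Complex.add_im, Complex.one_im, Complex.mul_im,
      Complex.ofReal_re, Complex.ofReal_im, Complex.zero_im, Complex.add_re, Complex.one_re,
      Complex.mul_re, Complex.zero_re, zero_mul, zero_add, add_zero, sub_zero] at h1 h2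
    have hs := (mul_eq_zero.1 h1).resolve_right him
    simp [hs] at h2
  rw [aeval_mobius s hd hne] at hz
  have hw := hp.im_eq_zero h0 ((mul_eq_zero.1 hz).resolve_left (pow_ne_zero d hne))
  set w := z / (1 + algebraMap ℝ ℂ s * z) with hwdef
  have hzw : z = w * (1 + algebraMap ℝ ℂ s * z) := (div_mul_cancel₀ _ hne).symm
  -- With `w` real, the imaginary part of `z = w (1 + s z)` gives `w s = 1`; the real part then
  -- gives `w = 0`.
  have h1 := congrArg Complex.im hzw
  have h2 := congrArg Complex.re hzw
  simp only [Complex.coe_algebraMap, Complex.add_im, Complex.one_im, Complex.mul_im,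
    Complex.ofReal_re, Complex.ofReal_im, Complex.add_re, Complex.one_re,
    Complex.mul_re, zero_mul, zero_add, add_zero, sub_zero, hw] at h1 h2
  have h3 : w.re * s = 1 := mul_left_cancel₀ him (by linear_combination -h1)
  have h4 : w.re = 0 := by linear_combination -h2 - z.re * h3
  simp [h4] at h3

/-- The substitution sends infinity to `1/s`, so a degree drop of two or more would be a multiple
root of `p` there. Inverting it shows this: each term of index `i ≤ deg q` carries `(1 - sX)^(d -
i)` with `d - i ≥ 2`. -/
theorem le_natDegree_mobius_add_one {d : ℕ} {s : ℝ} (hs : s ≠ 0) {p : ℝ[X]} (h0 : p ≠ 0)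
    (hd : p.natDegree ≤ d) (hmult : ∀ t, p.rootMultiplicity t ≤ 1) :
    d ≤ (mobius d s p).natDegree + 1 := by
  by_contra! hlt
  set q := mobius d s p with hq
  have hdvd : (X - C s⁻¹) ^ 2 ∣ p := by
    have hlin : (1 + C (-s) * X : ℝ[X]) = C (-s) * (X - C s⁻¹) := by
      rw [mul_sub, ← C_mul, neg_mul, mul_inv_cancel₀ hs]; simp; ring
    rw [← mobius_neg_mobius s hd, mobius_apply, ← hq]
    refine Finset.dvd_sum fun i _ => ?_
    by_cases hi : q.natDegree < i
    · simp [coeff_eq_zero_of_natDegree_lt hi]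
    · refine Dvd.dvd.mul_left (Dvd.dvd.mul_left ?_ _) _
      rw [hlin, mul_pow]
      exact Dvd.dvd.mul_left (pow_dvd_pow _ (by omega)) _
  have := (le_rootMultiplicity_iff h0).2 hdvd
  have := hmult s⁻¹
  omega

/-! ### The perturbation operator -/

/-- A perturbation of the identity that separates all roots, including those at infinity. -/
def separate (d : ℕ) (s : ℝ) : ℝ[X] →ₗ[ℝ] ℝ[X] :=
  (addDeriv s ^ d) ∘ₗ mobius d s ∘ₗ (addDeriv s ^ d)

theorem natDegree_addDeriv_pow (s : ℝ) (k : ℕ) (p : ℝ[X]) :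
    ((addDeriv s ^ k) p).natDegree = p.natDegree := by
  induction k with
  | zero => simp
  | succ k ih => rw [pow_succ', Module.End.mul_apply, natDegree_addDeriv, ih]

theorem natDegree_separate_le (d : ℕ) (s : ℝ) (p : ℝ[X]) : (separate d s p).natDegree ≤ d := by
  simp only [separate, LinearMap.comp_apply, natDegree_addDeriv_pow]
  exact natDegree_mobius_le d s _

theorem separate_spec {d : ℕ} {s : ℝ} (hs : s ≠ 0) {p : ℝ[X]} (hp : p.Splits) (h0 : p ≠ 0)
    (hd : p.natDegree ≤ d) :
    (separate d s p).Splits ∧ separate d s p ≠ 0 ∧ d ≤ (separate d s p).natDegree + 1 ∧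
      ∀ t, (separate d s p).rootMultiplicity t ≤ 1 := by
  obtain ⟨h1, h2, h3, -⟩ := addDeriv_pow_spec hs hp h0 d
  have h4 := rootMultiplicity_addDeriv_pow_le_one hs hp h0 hd
  have hd' := h3.trans_le hd
  have h5 := h1.mobius s hd'
  have h6 := mobius_ne_zero s hd' h2
  obtain ⟨h7, h8, h9, -⟩ := addDeriv_pow_spec hs h5 h6 d
  refine ⟨h7, h8, ?_, rootMultiplicity_addDeriv_pow_le_one hs h5 h6 (natDegree_mobius_le d s _)⟩
  exact (le_natDegree_mobius_add_one hs h2 hd' h4).trans_eq (congrArg (· + 1) h9.symm)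

theorem separate_zero {d : ℕ} {p : ℝ[X]} (hd : p.natDegree ≤ d) : separate d 0 p = p := by
  have h : addDeriv 0 = 1 := by simp [addDeriv, Module.End.one_eq_id]
  simp only [separate, h, one_pow, LinearMap.comp_apply, Module.End.one_apply, mobius_apply]
  conv_rhs => rw [p.as_sum_range' (d + 1) (Nat.lt_succ_of_le hd)]
  simp [C_mul_X_pow_eq_monomial]

/-! ### Families of polynomials with continuous coefficients -/

/-- A one-parameter family of polynomials all of whose coefficients are continuous. -/
def ContinuousCoeff (p : ℝ → ℝ[X]) : Prop := ∀ i, Continuous fun s => (p s).coeff i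

namespace ContinuousCoeff

theorem const (p : ℝ[X]) : ContinuousCoeff fun _ => p := fun _ => continuous_const

theorem C {f : ℝ → ℝ} (hf : Continuous f) : ContinuousCoeff fun s => Polynomial.C (f s) :=
  fun i => by
    by_cases hi : i = 0
    · simpa [hi] using hf
    · simpa [coeff_C, hi] using continuous_const

variable {p q : ℝ → ℝ[X]}

theorem add (hp : ContinuousCoeff p) (hq : ContinuousCoeff q) :
    ContinuousCoeff fun s => p s + q s := fun i => by
  simpa only [coeff_add] using! (hp i).add (hq i)

theorem mul (hp : ContinuousCoeff p) (hq : ContinuousCoeff q) :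
    ContinuousCoeff fun s => p s * q s := fun i => by
  simp only [coeff_mul]
  exact continuous_finsetSum _ fun x _ => (hp x.1).mul (hq x.2)

theorem pow (hp : ContinuousCoeff p) (k : ℕ) : ContinuousCoeff fun s => p s ^ k := by
  induction k with
  | zero => simpa using const 1
  | succ k ih => simpa [pow_succ] using ih.mul hp

theorem sum {ι : Type*} (t : Finset ι) {p : ι → ℝ → ℝ[X]} (hp : ∀ i, ContinuousCoeff (p i)) :
    ContinuousCoeff fun s => ∑ i ∈ t, p i s := fun j => by
  simp only [finsetSum_coeff]
  exact continuous_finsetSum _ fun i _ => hp i j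

theorem derivative (hp : ContinuousCoeff p) :
    ContinuousCoeff fun s => Polynomial.derivative (p s) := fun i => by
  simp only [coeff_derivative]
  exact (hp (i + 1)).mul continuous_const

theorem addDeriv (hp : ContinuousCoeff p) : ContinuousCoeff fun s => addDeriv s (p s) := by
  simp only [addDeriv_apply]
  exact hp.add ((C continuous_id).mul hp.derivative)

theorem addDeriv_pow (hp : ContinuousCoeff p) (k : ℕ) :
    ContinuousCoeff fun s => (_root_.addDeriv s ^ k) (p s) := by
  induction k with
  | zero => simpa using hp
  | succ k ih => simpa only [pow_succ', Module.End.mul_apply] using ih.addDeriv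

theorem mobius (hp : ContinuousCoeff p) (d : ℕ) : ContinuousCoeff fun s => mobius d s (p s) := by
  simp only [mobius_apply]
  exact sum _ fun i => (C (hp i)).mul ((const _).mul
    (((const 1).add ((C continuous_id).mul (const X))).pow _))

theorem separate (d : ℕ) (p : ℝ[X]) : ContinuousCoeff fun s => separate d s p :=
  (((const p).addDeriv_pow d).mobius d).addDeriv_pow d

end ContinuousCoeff

/-! ### Stability of polynomials with simple real roots -/

-- Write `p = (X - r) u` with `u(r) ≠ 0`; the product is then `-δ² u(r - δ) u(r + δ)`.
open Filter Topology in
theorem eventually_eval_sub_mul_eval_add_neg {p : ℝ[X]} (h0 : p ≠ 0) {r : ℝ}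
    (hr : p.rootMultiplicity r = 1) :
    ∀ᶠ δ in 𝓝[>] (0 : ℝ), p.eval (r - δ) * p.eval (r + δ) < 0 := by
  obtain ⟨u, hu, hndvd⟩ := exists_eq_pow_rootMultiplicity_mul_and_not_dvd p h0 r
  rw [hr, pow_one] at hu
  rw [dvd_iff_isRoot] at hndvd
  have hc : Continuous fun δ : ℝ => u.eval (r - δ) * u.eval (r + δ) := by fun_prop
  have hpos : 0 < u.eval (r - 0) * u.eval (r + 0) := by
    simpa using mul_self_pos.2 hndvd
  filter_upwards [self_mem_nhdsWithin,
    (hc.continuousAt.eventually (lt_mem_nhds hpos)).filter_mono nhdsWithin_le_nhds] with δ h1 h2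
  have h1 : 0 < δ := h1
  rw [hu]
  simp only [eval_mul, eval_sub, eval_X, eval_C]
  have : (r - δ - r) * u.eval (r - δ) * ((r + δ - r) * u.eval (r + δ)) =
    -(δ ^ 2 * (u.eval (r - δ) * u.eval (r + δ))) := by ring
  rw [this]
  exact neg_neg_of_pos (by positivity)

theorem exists_root_of_eval_sub_mul_eval_add_neg {q : ℝ[X]} {r δ : ℝ} (hδ : 0 < δ)
    (h : q.eval (r - δ) * q.eval (r + δ) < 0) : ∃ y, |y - r| ≤ δ ∧ q.IsRoot y := by
  have hle : r - δ ≤ r + δ := by linarith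
  have hc : ContinuousOn (fun x => q.eval x) (Set.Icc (r - δ) (r + δ)) := q.continuous.continuousOn
  have key : ∃ y ∈ Set.Icc (r - δ) (r + δ), q.eval y = 0 := by
    rcases mul_neg_iff.1 h with ⟨h1, h2⟩ | ⟨h1, h2⟩
    · exact intermediate_value_Icc' hle hc ⟨h2.le, h1.le⟩
    · exact intermediate_value_Icc hle hc ⟨h1.le, h2.le⟩
  obtain ⟨y, hy, h0⟩ := key
  exact ⟨y, abs_le.2 ⟨by linarith [hy.1], by linarith [hy.2]⟩, h0⟩

-- For small `δ` the intervals `[r - δ, r + δ]` are disjoint, so the sign changes give `q` at least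
-- `deg p` distinct roots. The slack of one in the degree covers `deg p = d - 1` with `deg q = d`.
open Filter Topology in
theorem exists_sign_changes {p : ℝ[X]} (hp : p.Splits) (h0 : p ≠ 0)
    (hmult : ∀ t, p.rootMultiplicity t ≤ 1) :
    ∃ δ : ℝ, (∀ r ∈ p.roots.toFinset, p.eval (r - δ) * p.eval (r + δ) < 0) ∧
      ∀ q : ℝ[X], q.natDegree ≤ p.natDegree + 1 →
        (∀ r ∈ p.roots.toFinset, q.eval (r - δ) * q.eval (r + δ) < 0) → q.Splits := by
  have h1 : ∀ᶠ δ in 𝓝[>] (0 : ℝ), ∀ r ∈ p.roots.toFinset, p.eval (r - δ) * p.eval (r + δ) < 0 := by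
    refine (eventually_all_finset _).2 fun r hr => eventually_eval_sub_mul_eval_add_neg h0 ?_
    have := (rootMultiplicity_pos h0).2 (isRoot_of_mem_roots (Multiset.mem_toFinset.1 hr))
    exact le_antisymm (hmult r) this
  have h2 : ∀ᶠ δ in 𝓝[>] (0 : ℝ), ∀ r ∈ p.roots.toFinset, ∀ r' ∈ p.roots.toFinset,
      r ≠ r' → 2 * δ < |r - r'| := by
    refine (eventually_all_finset _).2 fun r _ => (eventually_all_finset _).2 fun r' _ => ?_
    by_cases h : r = r'
    · simp [h]
    · have hc : Continuous fun δ : ℝ => 2 * δ := by fun_prop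
      have : 2 * (0 : ℝ) < |r - r'| := by simpa [sub_eq_zero] using h
      exact ((hc.continuousAt.eventually (gt_mem_nhds this)).filter_mono
        nhdsWithin_le_nhds).mono fun _ h _ => h
  obtain ⟨δ, ⟨hδ1, hδ2⟩, hδ⟩ := ((h1.and h2).and self_mem_nhdsWithin).exists
  have hδ : 0 < δ := hδ
  refine ⟨δ, hδ1, fun q hq hsign => ?_⟩
  by_cases hq0 : q = 0
  · simp [hq0]
  choose! y hy hroot using fun r hr => exists_root_of_eval_sub_mul_eval_add_neg hδ (hsign r hr)
  have hinj : Set.InjOn y p.roots.toFinset := fun r hr r' hr' h => by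
    by_contra hne
    have h1 := hδ2 r hr r' hr' hne
    have h2 := abs_le.1 (hy r hr)
    have h3 := abs_le.1 (hy r' hr')
    rw [h] at h2
    exact absurd (abs_le.2 ⟨by linarith, by linarith⟩ : |r - r'| ≤ 2 * δ) (not_le.2 h1)
  have hcard : p.roots.toFinset.card ≤ q.roots.toFinset.card :=
    Finset.card_le_card_of_injOn y
      (fun r hr => Multiset.mem_toFinset.2 ((mem_roots hq0).2 (hroot r hr))) hinj
  have hnodup : p.roots.Nodup := Multiset.nodup_iff_count_le_one.2 fun t => by
    rw [count_roots]; exact hmult t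
  rw [Multiset.toFinset_card_of_nodup hnodup, ← hp.natDegree_eq_card_roots] at hcard
  have := Multiset.toFinset_card_le q.roots
  exact splits_of_natDegree_le_card_roots_add_one (by omega)

/-! ### Norms on `ℝ^d[t]` -/

theorem PolyLE.natDegree_le {d : ℕ} (p : PolyLE d) : (p : ℝ[X]).natDegree ≤ d :=
  natDegree_le_of_degree_le (mem_degreeLE.1 p.2)

theorem mem_degreeLE_of_natDegree_le {d : ℕ} {p : ℝ[X]} (h : p.natDegree ≤ d) :
    p ∈ degreeLE ℝ (d : WithBot ℕ) :=
  mem_degreeLE.2 (degree_le_of_natDegree_le h)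

instance (d : ℕ) : FiniteDimensional ℝ (PolyLE d) := by
  classical
  exact Module.Finite.iff_fg.2 ⟨_, degreeLE_eq_span_X_pow.symm⟩

theorem continuous_normTopology {d : ℕ} (N : Seminorm ℝ (PolyLE d)) (hN : ∀ p, N p = 0 → p = 0)
    (l : PolyLE d →ₗ[ℝ] ℝ) : @Continuous _ _ (normTopology N) _ l := by
  -- All these structures carry the topology `normTopology N`, so finite-dimensional continuity
  -- applies to it.
  let : SeminormedAddCommGroup (PolyLE d) := N.toAddGroupSeminorm.toSeminormedAddCommGroup
  let : NormedSpace ℝ (PolyLE d) := ⟨fun a p => (map_smul_eq_mul N a p).le⟩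
  let : NormedAddCommGroup (PolyLE d) := NormedAddCommGroup.ofSeparation hN
  exact l.continuous_of_finiteDimensional

/-- Evaluation at a point as a linear functional on `ℝ^d[t]`. -/
def evalPolyLE (d : ℕ) (x : ℝ) : PolyLE d →ₗ[ℝ] ℝ :=
  leval x ∘ₗ (degreeLE ℝ (d : WithBot ℕ)).subtype

/-- The sign conditions are finitely many strict inequalities between continuous functions, hence
define an open neighbourhood. -/
theorem mem_interior_realRootedSet {d : ℕ} (N : Seminorm ℝ (PolyLE d))
    (hN : ∀ p, N p = 0 → p = 0) (p : PolyLE d) (hp : (p : ℝ[X]).Splits) (h0 : (p : ℝ[X]) ≠ 0)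
    (hd : d ≤ (p : ℝ[X]).natDegree + 1) (hmult : ∀ t, (p : ℝ[X]).rootMultiplicity t ≤ 1) :
    p ∈ @interior (PolyLE d) (normTopology N) (realRootedSet d) := by
  obtain ⟨δ, h1, h2⟩ := exists_sign_changes hp h0 hmult
  let : TopologicalSpace (PolyLE d) := normTopology N
  have hc : ∀ x, Continuous (evalPolyLE d x) := fun x => continuous_normTopology N hN _
  refine mem_interior.2 ⟨⋂ r ∈ (p : ℝ[X]).roots.toFinset,
    {q | evalPolyLE d (r - δ) q * evalPolyLE d (r + δ) q < 0}, fun q hq => ?_,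
    isOpen_biInter_finset fun r _ => isOpen_lt ((hc _).mul (hc _)) continuous_const,
    Set.mem_iInter₂.2 h1⟩
  exact realRooted_iff_splits.2 (h2 q (PolyLE.natDegree_le q |>.trans hd)
    fun r hr => Set.mem_iInter₂.1 hq r hr)

open Filter Topology in
theorem tendsto_seminorm_sub {d : ℕ} (N : Seminorm ℝ (PolyLE d)) {g : ℝ → PolyLE d}
    (hg : ContinuousCoeff fun s => (g s : ℝ[X])) :
    Tendsto (fun s => N (g 0 - g s)) (𝓝 0) (𝓝 0) := by
  -- The monomial basis; the value `0` for `i > d` is never used.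
  let e : ℕ → PolyLE d := fun i =>
    if h : i ≤ d then ⟨X ^ i, mem_degreeLE_of_natDegree_le ((natDegree_X_pow_le i).trans h)⟩ else 0
  have hsum : ∀ p : PolyLE d, p = ∑ i ∈ Finset.range (d + 1), (p : ℝ[X]).coeff i • e i := by
    intro p
    refine Subtype.ext ?_
    conv_lhs => rw [(p : ℝ[X]).as_sum_range' (d + 1) (Nat.lt_succ_of_le p.natDegree_le)]
    rw [Submodule.coe_sum]
    refine Finset.sum_congr rfl fun i hi => ?_
    have : i ≤ d := Nat.lt_succ_iff.1 (Finset.mem_range.1 hi)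
    simp [e, this, smul_eq_C_mul, C_mul_X_pow_eq_monomial]
  have hle : ∀ p : PolyLE d, N p ≤ ∑ i ∈ Finset.range (d + 1), |(p : ℝ[X]).coeff i| * N (e i) := by
    intro p
    conv_lhs => rw [hsum p]
    refine (Finset.le_sum_of_subadditive N (map_zero N).le (map_add_le_add N) _ _).trans_eq ?_
    simp [map_smul_eq_mul]
  have hc : Continuous fun s => ∑ i ∈ Finset.range (d + 1),
      |((g 0 - g s : PolyLE d) : ℝ[X]).coeff i| * N (e i) := by
    refine continuous_finsetSum _ fun i _ => Continuous.mul (Continuous.abs ?_) continuous_const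
    simpa only [Submodule.coe_sub, coeff_sub] using! continuous_const.sub (hg i)
  have hlim := hc.tendsto 0
  simp only [sub_self, ZeroMemClass.coe_zero, coeff_zero, abs_zero, zero_mul,
    Finset.sum_const_zero] at hlim
  exact squeeze_zero (fun s => apply_nonneg N _) (fun s => hle _) hlim

/-- The operator `separate` on `ℝ^d[t]`. -/
def separatePolyLE (d : ℕ) (s : ℝ) : PolyLE d →ₗ[ℝ] PolyLE d :=
  (separate d s).restrict fun _ _ => mem_degreeLE_of_natDegree_le (natDegree_separate_le d s _)

theorem Compatible.polySimplex_subset {d n : ℕ} {f : Fin n → PolyLE d} (hf : Compatible f) :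
    polySimplex f ⊆ realRootedSet d := by
  have h : polySimplex f ⊆ {p | ∃ a : Fin n → ℝ, (∀ i, 0 ≤ a i) ∧ ∑ i, a i • f i = p} := by
    refine convexHull_min ?_ ?_
    · rintro _ ⟨i, rfl⟩
      exact ⟨Pi.single i 1, (Pi.single_nonneg.2 zero_le_one : (0 : Fin n → ℝ) ≤ Pi.single i 1),
        by simp [Pi.single_apply]⟩
    · rintro _ ⟨a, ha, rfl⟩ _ ⟨b, hb, rfl⟩ u v hu hv -
      refine ⟨fun i => u * a i + v * b i,
        fun i => add_nonneg (mul_nonneg hu (ha i)) (mul_nonneg hv (hb i)), ?_⟩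
      simp only [add_smul, mul_smul, Finset.sum_add_distrib, Finset.smul_sum]
  intro p hp
  obtain ⟨a, ha, rfl⟩ := h hp
  exact hf a ha

open Filter Topology in
theorem theorem1p4 (d n : ℕ) (N : Seminorm ℝ (PolyLE d)) (hN : ∀ p, N p = 0 → p = 0)
    (f : Fin n → PolyLE d) (hf : Compatible f) (h0 : (0 : PolyLE d) ∉ polySimplex f) :
    ∃ ε₀ : ℝ, 0 < ε₀ ∧ ∀ ε : ℝ, 0 < ε → ε < ε₀ →
      ∃ g : Fin n → PolyLE d, (∀ i, N (f i - g i) < ε) ∧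
        polySimplex g ⊆ @interior (PolyLE d) (normTopology N) (realRootedSet d) := by
  -- The bound `1` is arbitrary: every positive `ε` works.
  refine ⟨1, one_pos, fun ε hε _ => ?_⟩
  have hlim : ∀ i, ∀ᶠ s in 𝓝[>] (0 : ℝ), N (f i - separatePolyLE d s (f i)) < ε := fun i => by
    have h := tendsto_seminorm_sub N (g := fun s => separatePolyLE d s (f i))
      (ContinuousCoeff.separate d (f i))
    have h00 : separatePolyLE d 0 (f i) = f i := Subtype.ext (separate_zero (f i).natDegree_le)
    rw [h00] at h
    exact (h.eventually (gt_mem_nhds hε)).filter_mono nhdsWithin_le_nhds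
  obtain ⟨s, hs, hpos⟩ := ((eventually_all.2 hlim).and self_mem_nhdsWithin).exists
  refine ⟨fun i => separatePolyLE d s (f i), hs, ?_⟩
  have himg : polySimplex (fun i => separatePolyLE d s (f i)) =
      separatePolyLE d s '' polySimplex f := by
    rw [polySimplex, polySimplex, LinearMap.image_convexHull, ← Set.range_comp]; rfl
  rw [himg]
  rintro _ ⟨p, hp, rfl⟩
  have hne : (p : ℝ[X]) ≠ 0 := fun h => h0 (by rwa [← Subtype.ext (a2 := (0 : PolyLE d)) h])
  obtain ⟨h1, h2, h3, h4⟩ := separate_spec (ne_of_gt hpos)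
    (realRooted_iff_splits.1 (hf.polySimplex_subset hp)) hne p.natDegree_le
  exact mem_interior_realRootedSet N hN _ h1 h2 h3 h4

end
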